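/- Let $B=(B(i,j))_{i,j\in\mathbb N}$ be a matrix of zeros and ones with no row and no column made entirely of zeros, let $$\Sigma=\{(x_n)_{n\in\mathbb N}\in\mathbb N^{\mathbb N}: B(x_n,x_{n+1})=1\text{ for all }n\}$$ be the associated one-sided countable Markov shift with shift map $\sigma(x_0,x_1,x_2,\dots)=(x_1,x_2,\dots)$, and equip $\Sigma$ with the metric $d(x,y)=2^{-k}$, where $k$ is the first index at which $x$ and $y$ differ (and $d(x,x)=0$). Assume that $(\Sigma,\sigma)$ is transitive: for all non-empty open sets $U,V\subset\Sigma$ there is $n\in\mathbb N$ with $U\cap\sigma^{-n}V\neq\emptyset$. Let $\tau:\Sigma\to\mathbb R$ be uniformly continuous and such that $var_2(\tau)=\sup\{|\tau(x)-\tau(y)|: d(x,y)\le 2^{-2}\}$ is finite. Let $\mu$ be a $\sigma$-invariant Borel probability measure on $\Sigma$ with $\tau\in L^1(\mu)$ (if $\tau$ is non-negative, in particular if $\tau$ is positive and bounded away from zero, this means $\int\tau\,d\mu<\infty$). Then there exists a sequence $(\mu_n)_n$ of periodic measures, that is, of ergodic $\sigma$-invariant Borel probability measures each supported on the orbit of a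 periodic point, such that $\mu_n\to\mu$ in the weak* topology (i.e. $\int f\,d\mu_n\to\int f\,d\mu$ for every bounded continuous $f:\Sigma\to\mathbb R$) and $$\lim_{n\to\infty}\int\tau\,d\mu_n=\int\tau\,d\mu.$$ -/

import Mathlib

open MeasureTheory Filter Topology

/-- A `0`-`1` matrix indexed by the natural numbers is a transition matrix if no row and no column
is made entirely of zeros. -/
def IsTransitionMatrix (B : Matrix ℕ ℕ (Fin 2)) : Prop :=
  (∀ i, ∃ j, B i j = 1) ∧ (∀ j, ∃ i, B i j = 1)

/-- The one-sided countable Markov shift space: all sequences whose consecutive letters are allowed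
by the matrix `B`. Coordinates are indexed from `0`. -/
def MarkovShift (B : Matrix ℕ ℕ (Fin 2)) : Type :=
  {x : ℕ → ℕ // ∀ n, B (x n) (x (n + 1)) = 1}

namespace MarkovShift

/-- The metric `d(x, y) = 2 ^ (-k)`, where `k` is the first index at which `x` and `y` differ
(and `d(x, x) = 0`). Its topology is generated by the cylinder sets. -/
noncomputable instance instMetricSpace (B : Matrix ℕ ℕ (Fin 2)) : MetricSpace (MarkovShift B) :=
  MetricSpace.induced Subtype.val Subtype.val_injective PiNat.metricSpaceNatNat

noncomputable instance instMeasurableSpace (B : Matrix ℕ ℕ (Fin 2)) : MeasurableSpace (MarkovShift B) :=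
  borel (MarkovShift B)

instance instBorelSpace (B : Matrix ℕ ℕ (Fin 2)) : BorelSpace (MarkovShift B) := ⟨rfl⟩

/-- The shift map, `(x₀, x₁, x₂, …) ↦ (x₁, x₂, …)`. -/
def shift (B : Matrix ℕ ℕ (Fin 2)) (x : MarkovShift B) : MarkovShift B :=
  ⟨fun n => x.1 (n + 1), fun n => x.2 (n + 1)⟩

/-- Two points are at distance at most `2 ^ (-n)` exactly when their first `n` coordinates agree. -/
theorem dist_le_iff {B : Matrix ℕ ℕ (Fin 2)} (x y : MarkovShift B) (n : ℕ) :
    dist x y ≤ (1 / 2 : ℝ) ^ n ↔ ∀ i < n, x.1 i = y.1 i := by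
  have h : y.1 ∈ PiNat.cylinder x.1 n ↔ @dist _ PiNat.dist y.1 x.1 ≤ (1 / 2 : ℝ) ^ n :=
    PiNat.mem_cylinder_iff_dist_le
  rw [dist_comm]
  refine h.symm.trans ?_
  simp only [PiNat.mem_cylinder_iff, eq_comm]

/-- Topological transitivity: some iterate of every non-empty open set meets every other one. -/
def IsTransitive (B : Matrix ℕ ℕ (Fin 2)) : Prop :=
  ∀ U V : Set (MarkovShift B), IsOpen U → IsOpen V → U.Nonempty → V.Nonempty →
    ∃ n : ℕ, (U ∩ (shift B)^[n] ⁻¹' V).Nonempty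

/-- The `n`-th variation of `φ`, with values in `[0, ∞]`: the supremum of `|φ x - φ y|` over all
`x`, `y` with `d(x, y) ≤ 2 ^ (-n)`. -/
noncomputable def variation {B : Matrix ℕ ℕ (Fin 2)} (φ : MarkovShift B → ℝ) (n : ℕ) : ENNReal :=
  ⨆ (x : MarkovShift B) (y : MarkovShift B) (_ : dist x y ≤ (1 / 2 : ℝ) ^ n),
    ENNReal.ofReal |φ x - φ y|

/-- The set of shift-invariant Borel probability measures. -/
def invariantMeasures (B : Matrix ℕ ℕ (Fin 2)) : Set (ProbabilityMeasure (MarkovShift B)) :=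
  {μ | MeasurePreserving (shift B) (μ : Measure (MarkovShift B)) (μ : Measure (MarkovShift B))}

/-- The set of shift-invariant Borel probability measures with respect to which `τ` is integrable.
For a non-negative `τ` this says `∫ τ dμ < ∞`, see `mem_integrableMeasures_iff`. -/
def integrableMeasures (B : Matrix ℕ ℕ (Fin 2)) (τ : MarkovShift B → ℝ) :
    Set (ProbabilityMeasure (MarkovShift B)) :=
  {μ | μ ∈ invariantMeasures B ∧ Integrable τ (μ : Measure (MarkovShift B))}

theorem mem_integrableMeasures_iff {B : Matrix ℕ ℕ (Fin 2)} {τ : MarkovShift B → ℝ}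
    (hτ : Continuous τ) (h0 : ∀ x, 0 ≤ τ x) (μ : ProbabilityMeasure (MarkovShift B)) :
    μ ∈ integrableMeasures B τ ↔ μ ∈ invariantMeasures B ∧
      ∫⁻ x, ENNReal.ofReal (τ x) ∂(μ : Measure (MarkovShift B)) < ⊤ := by
  have hm : AEStronglyMeasurable τ (μ : Measure (MarkovShift B)) :=
    hτ.measurable.aestronglyMeasurable
  refine and_congr_right fun _ => ?_
  rw [← hasFiniteIntegral_iff_ofReal (Eventually.of_forall h0)]
  exact ⟨fun h => h.2, fun h => ⟨hm, h⟩⟩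

/-- The set of periodic measures: ergodic shift-invariant probability measures that give full mass
to the orbit of a periodic point. -/
def periodicMeasures (B : Matrix ℕ ℕ (Fin 2)) : Set (ProbabilityMeasure (MarkovShift B)) :=
  {ν | Ergodic (shift B) (ν : Measure (MarkovShift B)) ∧
    ∃ p ∈ Function.periodicPts (shift B),
      (ν : Measure (MarkovShift B)) (Set.range fun k : ℕ => (shift B)^[k] p)ᶜ = 0}

end MarkovShift

/-! ### Gluing, periodic points and connecting words -/

namespace MarkovShift

variable {B : Matrix ℕ ℕ (Fin 2)}

/-! It suffices to approximate finitely many integrals at once, those of `τ` and of cylinder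
indicators. Fix a finite alphabet carrying most of the mass of `x₀`. Transitivity supplies finitely
many connecting words between its letters, with bounded cost. For large `N`, draw i.i.d. points from
`μ` conditioned on `x₀` and `x_N` lying in this alphabet. The strong law makes the averages of their
`N`-step Birkhoff sums close to `N ∫ f dμ`; independent sampling replaces the ergodic theorem, so
`μ` need not be ergodic. Joining the sampled blocks by connectors and closing up yields a periodic
point (`exists_chain`, `exists_isPeriodicPt`). Per block, the errors are a sum of variations, which
is `o(N)`, and a connector cost independent of `N`. Integrability of `τ` makes the conditioning
harmless (`eventually_abs_integral_cond_comp_sub_le`). -/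

theorem iterate_shift_apply (x : MarkovShift B) (n k : ℕ) :
    ((shift B)^[n] x).1 k = x.1 (k + n) := by
  induction n generalizing k with
  | zero => rfl
  | succ n ih =>
    rw [Function.iterate_succ_apply']
    change ((shift B)^[n] x).1 (k + 1) = _
    rw [ih, add_right_comm, add_assoc]

/-- Follow `x` up to time `n` and then `y`. -/
def glue (x : MarkovShift B) (n : ℕ) (y : MarkovShift B) (h : x.1 n = y.1 0) : MarkovShift B :=
  ⟨fun i => if i < n then x.1 i else y.1 (i - n), fun i => by
    change B (if i < n then x.1 i else y.1 (i - n))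
      (if i + 1 < n then x.1 (i + 1) else y.1 (i + 1 - n)) = 1
    rcases lt_trichotomy (i + 1) n with hi | hi | hi
    · rw [if_pos hi, if_pos (by omega)]
      exact x.2 i
    · have := x.2 i
      rw [hi, h] at this
      rw [if_pos (by omega), if_neg (by omega), hi, Nat.sub_self]
      exact this
    · rw [if_neg (by omega), if_neg (by omega), Nat.sub_add_comm (by omega)]
      exact y.2 (i - n)⟩

theorem glue_apply_of_le {x : MarkovShift B} {n : ℕ} {y : MarkovShift B} (h : x.1 n = y.1 0)
    {i : ℕ} (hi : i ≤ n) : (glue x n y h).1 i = x.1 i := by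
  rcases hi.lt_or_eq with hi | rfl
  · simp [glue, hi]
  · simp [glue, h]

theorem glue_apply_add {x : MarkovShift B} {n : ℕ} {y : MarkovShift B} (h : x.1 n = y.1 0)
    (i : ℕ) : (glue x n y h).1 (i + n) = y.1 i := by
  simp [glue]

theorem exists_isPeriodicPt {x : MarkovShift B} {P : ℕ} (hP : 0 < P) (hx : x.1 P = x.1 0) :
    ∃ p : MarkovShift B, Function.IsPeriodicPt (shift B) P p ∧ ∀ i ≤ P, p.1 i = x.1 i := by
  refine ⟨⟨fun i => x.1 (i % P), fun i => ?_⟩, ?_, fun i hi => ?_⟩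
  · have h1 := x.2 (i % P)
    have hlt := Nat.mod_lt i hP
    rcases (Nat.succ_le_of_lt hlt).lt_or_eq with h | h
    · have h2 : (i + 1) % P = i % P + 1 := by
        rw [← Nat.mod_add_mod, Nat.mod_eq_of_lt h]
      simpa only [h2] using h1
    · have h2 : (i + 1) % P = 0 := by
        rw [← Nat.mod_add_mod, show i % P + 1 = P from h, Nat.mod_self]
      rw [show i % P + 1 = P from h, hx] at h1
      simpa only [h2] using h1
  · refine Subtype.ext (funext fun k => ?_)
    exact (iterate_shift_apply _ _ _).trans (by simp)
  · rcases hi.lt_or_eq with hi | rfl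
    · simp [Nat.mod_eq_of_lt hi]
    · simp [hx]

theorem exists_apply_zero_eq (hB : IsTransitionMatrix B) (a : ℕ) :
    ∃ x : MarkovShift B, x.1 0 = a := by
  choose g hg using hB.1
  refine ⟨⟨fun n => g^[n] a, fun n => ?_⟩, rfl⟩
  simp only [Function.iterate_succ_apply']
  exact hg _

theorem isOpen_setOf_agree (x : MarkovShift B) (n : ℕ) :
    IsOpen {y : MarkovShift B | ∀ i < n, y.1 i = x.1 i} := by
  refine Metric.isOpen_iff.2 fun y hy => ⟨(1 / 2) ^ n, by positivity, fun z hz i hi => ?_⟩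
  rw [← hy i hi]
  exact (dist_le_iff z y n).1 (Metric.mem_ball.1 hz).le i hi

theorem continuous_coord (k : ℕ) : Continuous fun x : MarkovShift B => x.1 k := by
  refine continuous_discrete_rng.2 fun a => isOpen_iff_forall_mem_open.2 fun x hx =>
    ⟨_, fun y hy => ?_, isOpen_setOf_agree x (k + 1), fun i _ => rfl⟩
  exact (hy k (Nat.lt_succ_self k)).trans hx

theorem continuous_shift : Continuous (shift B) := by
  refine continuous_def.2 fun U hU => isOpen_iff_forall_mem_open.2 fun x hx => ?_
  obtain ⟨ε, hε, hU⟩ := Metric.isOpen_iff.1 hU _ hx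
  obtain ⟨n, hn⟩ := exists_pow_lt_of_lt_one hε (by norm_num : (1 / 2 : ℝ) < 1)
  refine ⟨_, fun y hy => hU ?_, isOpen_setOf_agree x (n + 1), fun i _ => rfl⟩
  exact Metric.mem_ball.2 <| lt_of_le_of_lt
    ((dist_le_iff _ _ n).2 fun i hi => hy (i + 1) (by omega)) hn

theorem exists_connector (hB : IsTransitionMatrix B) (htrans : IsTransitive B) (a b : ℕ) :
    ∃ (c : MarkovShift B) (l : ℕ), c.1 0 = a ∧ c.1 l = b := by
  obtain ⟨x, hx⟩ := exists_apply_zero_eq hB a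
  obtain ⟨y, hy⟩ := exists_apply_zero_eq hB b
  have ho (d : ℕ) : IsOpen {z : MarkovShift B | z.1 0 = d} :=
    (isOpen_discrete {d}).preimage (continuous_coord 0)
  obtain ⟨n, c, hc, hn⟩ := htrans _ _ (ho a) (ho b) ⟨x, hx⟩ ⟨y, hy⟩
  refine ⟨c, n, hc, ?_⟩
  have : ((shift B)^[n] c).1 0 = b := hn
  rwa [iterate_shift_apply, zero_add] at this

/-! ### Birkhoff sums along concatenated blocks -/

/-- `V` controls the oscillation of `f` on cylinders of length at least two, and tends to zero. -/
structure IsRegular (f : MarkovShift B → ℝ) (V : ℕ → ℝ) : Prop where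
  abs_sub_le : ∀ n x y, (∀ i < n + 2, x.1 i = y.1 i) → |f x - f y| ≤ V n
  tendsto_zero : Tendsto V atTop (𝓝 0)

/-- At time `k < N` the coordinates `k, …, N` still agree, which is `(N - 1 - k) + 2` of them.
Agreement at index `N` itself is why control from the second variation on suffices. -/
theorem IsRegular.abs_birkhoffSum_sub_le {f : MarkovShift B → ℝ} {V : ℕ → ℝ}
    (hf : IsRegular f V) {N : ℕ} {x y : MarkovShift B} (h : ∀ i ≤ N, y.1 i = x.1 i) :
    |birkhoffSum (shift B) f N y - birkhoffSum (shift B) f N x| ≤ ∑ k ∈ Finset.range N, V k := by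
  rw [← Finset.sum_range_reflect V, birkhoffSum, birkhoffSum, ← Finset.sum_sub_distrib]
  refine (Finset.abs_sum_le_sum_abs _ _).trans (Finset.sum_le_sum fun k hk => ?_)
  rw [Finset.mem_range] at hk
  refine hf.abs_sub_le _ _ _ fun i hi => ?_
  rw [iterate_shift_apply, iterate_shift_apply]
  exact h _ (by omega)

variable {F : Set ℕ} {N L : ℕ} {c : ℕ → ℕ → MarkovShift B} {l : ℕ → ℕ → ℕ}

/-- The word follows `x` up to `N`, then the connector from `x_N` to `b`. It is chosen before `f`,
so one word serves all functions; `y` is arbitrary beyond `P`, so the bound passes to longer gluings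
and to the periodic point. -/
theorem exists_block (hc : ∀ a ∈ F, ∀ b ∈ F, (c a b).1 0 = a ∧ (c a b).1 (l a b) = b ∧ l a b ≤ L)
    {x : MarkovShift B} (hx : x.1 N ∈ F) {b : ℕ} (hb : b ∈ F) :
    ∃ (z : MarkovShift B) (P : ℕ), z.1 0 = x.1 0 ∧ z.1 P = b ∧ N ≤ P ∧ P ≤ N + L ∧
      ∀ f V, IsRegular f V → ∀ K, (∀ a ∈ F, ∀ b ∈ F, |birkhoffSum (shift B) f (l a b) (c a b)| +
        ∑ k ∈ Finset.range (l a b), V k ≤ K) → ∀ y : MarkovShift B, (∀ i ≤ P, y.1 i = z.1 i) →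
        |birkhoffSum (shift B) f P y - birkhoffSum (shift B) f N x| ≤
          ∑ k ∈ Finset.range N, V k + K := by
  obtain ⟨h0, h1, h2⟩ := hc _ hx b hb
  refine ⟨glue x N _ h0.symm, N + l (x.1 N) b, glue_apply_of_le _ (Nat.zero_le _), ?_, by omega,
    by omega, fun f V hf K hK y hy => ?_⟩
  · rw [add_comm, glue_apply_add, h1]
  · have e1 := hf.abs_birkhoffSum_sub_le (N := N) (x := x) (y := y) fun i hi => by
      rw [hy i (by omega), glue_apply_of_le _ hi]
    have e2 := hf.abs_birkhoffSum_sub_le (N := l (x.1 N) b) (x := c (x.1 N) b)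
      (y := (shift B)^[N] y) fun i hi => by
        rw [iterate_shift_apply, hy _ (by omega), glue_apply_add]
    have e3 := hK _ hx b hb
    rw [birkhoffSum_add]
    have e4 := abs_add_le (birkhoffSum (shift B) f N y - birkhoffSum (shift B) f N x)
      (birkhoffSum (shift B) f (l (x.1 N) b) ((shift B)^[N] y))
    have e5 := abs_sub_abs_le_abs_sub (birkhoffSum (shift B) f (l (x.1 N) b) ((shift B)^[N] y))
      (birkhoffSum (shift B) f (l (x.1 N) b) (c (x.1 N) b))
    rw [add_sub_right_comm]
    linarith

theorem exists_chain (hc : ∀ a ∈ F, ∀ b ∈ F, (c a b).1 0 = a ∧ (c a b).1 (l a b) = b ∧ l a b ≤ L)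
    {x : ℕ → MarkovShift B} (hx : ∀ i, (x i).1 0 ∈ F ∧ (x i).1 N ∈ F) (M : ℕ) {b : ℕ}
    (hb : b ∈ F) :
    ∃ (z : MarkovShift B) (P : ℕ), z.1 0 = (x 0).1 0 ∧ z.1 P = b ∧
      (M + 1) * N ≤ P ∧ P ≤ (M + 1) * (N + L) ∧
      ∀ f V, IsRegular f V → ∀ K, (∀ a ∈ F, ∀ b ∈ F, |birkhoffSum (shift B) f (l a b) (c a b)| +
        ∑ k ∈ Finset.range (l a b), V k ≤ K) → ∀ y : MarkovShift B, (∀ i ≤ P, y.1 i = z.1 i) →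
        |birkhoffSum (shift B) f P y -
          ∑ i ∈ Finset.range (M + 1), birkhoffSum (shift B) f N (x i)| ≤
          (M + 1) * (∑ k ∈ Finset.range N, V k + K) := by
  induction M generalizing b with
  | zero => simpa using exists_block hc (hx 0).2 hb
  | succ M ih =>
    -- The shorter chain is made to end at the first letter of the next sample.
    obtain ⟨z, P, hz0, hzP, hP1, hP2, hz⟩ := ih (hx (M + 1)).1
    obtain ⟨w, Q, hw0, hwQ, hQ1, hQ2, hw⟩ := exists_block hc (hx (M + 1)).2 hb
    have hzw : z.1 P = w.1 0 := hzP.trans hw0.symm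
    refine ⟨glue z P w hzw, P + Q, ?_, ?_, by linarith, by linarith, fun f V hf K hK y hy => ?_⟩
    · rw [glue_apply_of_le _ (Nat.zero_le _), hz0]
    · rw [add_comm, glue_apply_add, hwQ]
    · have e1 := hz f V hf K hK y fun i hi => by
        rw [hy i (by omega), glue_apply_of_le _ hi]
      have e2 := hw f V hf K hK ((shift B)^[P] y) fun i hi => by
        rw [iterate_shift_apply, hy _ (by omega), glue_apply_add]
      rw [birkhoffSum_add, Finset.sum_range_succ, add_sub_add_comm]
      refine (abs_add_le _ _).trans ((add_le_add e1 e2).trans (le_of_eq ?_))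
      push_cast
      ring

end MarkovShift

/-! ### Conditioning and random sampling -/

theorem tendsto_integral_abs_sub_max_zero {X : Type*} [MeasurableSpace X] {μ : Measure X}
    {f : X → ℝ} (hf : Integrable f μ) :
    Tendsto (fun R : ℕ => ∫ x, max (|f x| - R) 0 ∂μ) atTop (𝓝 0) := by
  have h := tendsto_integral_of_dominated_convergence (μ := μ)
    (F := fun (R : ℕ) x => max (|f x| - R) 0) (f := fun _ => (0 : ℝ)) (fun x => |f x|)
    (fun R => ((hf.abs.1.sub aestronglyMeasurable_const).sup aestronglyMeasurable_const)) hf.abs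
    (fun R => Eventually.of_forall fun x => ?_) (Eventually.of_forall fun x => ?_)
  · simpa using h
  · rw [Real.norm_of_nonneg (le_max_right _ _)]
    exact max_le (by linarith [(Nat.cast_nonneg R : (0 : ℝ) ≤ R)]) (abs_nonneg _)
  · obtain ⟨n, hn⟩ := exists_nat_ge |f x|
    refine tendsto_const_nhds.congr' (eventually_atTop.2 ⟨n, fun R hR => ?_⟩)
    refine (max_eq_right ?_).symm
    have : (n : ℝ) ≤ R := Nat.cast_le.2 hR
    linarith

/-- Conditioning on a set of almost full measure hardly changes an integral, uniformly along the
measure preserving maps. -/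
theorem eventually_abs_integral_cond_comp_sub_le {X : Type*} [MeasurableSpace X] {μ : Measure X}
    [IsProbabilityMeasure μ] {f : X → ℝ} (hf : Integrable f μ) {ε : ℝ} (hε : 0 < ε) :
    ∀ᶠ δ in 𝓝[>] (0 : ℝ), ∀ φ : X → X, MeasurePreserving φ μ μ → ∀ G : Set X, MeasurableSet G →
      μ.real Gᶜ ≤ δ →
        |∫ x, f (φ x) ∂(ProbabilityTheory.cond μ G) - ∫ x, f x ∂μ| ≤ ε := by
  obtain ⟨R, hR⟩ := ((tendsto_integral_abs_sub_max_zero hf).eventually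
    (gt_mem_nhds (by positivity : 0 < ε / 4))).exists
  set I := ∫ x, f x ∂μ with hI
  -- The bound `1 / 2` gives `μ(G)⁻¹ ≤ 2`; the other makes `δ (|I| + R) ≤ ε / 4`, matching the tail
  -- `ε / 4`.
  set δ₀ := min (1 / 2) (ε / (4 * (|I| + R + 1))) with hδ₀
  have hpos : 0 < |I| + R + 1 := by positivity
  filter_upwards [Ioc_mem_nhdsGT (by positivity : 0 < δ₀)] with δ hδ φ hφ G hG hGδ
  have hδ1 : δ ≤ 1 / 2 := hδ.2.trans (min_le_left _ _)
  have hδ2 : δ * (|I| + R + 1) ≤ ε / 4 := by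
    have := hδ.2.trans (min_le_right _ _)
    rw [le_div_iff₀ (by positivity)] at this
    linarith
  have hfφ : Integrable (fun x => f (φ x)) μ := hφ.integrable_comp_of_integrable hf
  have hcomp : ∀ u : X → ℝ, Integrable u μ → ∫ x, u (φ x) ∂μ = ∫ x, u x ∂μ := fun u hu => by
    have h := integral_map (f := u) hφ.measurable.aemeasurable (hφ.map_eq.symm ▸ hu.1)
    rw [hφ.map_eq] at h
    exact h.symm
  have hint : ∫ x, f (φ x) ∂μ = I := hcomp f hf
  have hg : Integrable (fun x => max (|f x| - R) 0) μ :=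
    (hf.abs.sub (integrable_const _)).sup (integrable_const _)
  have hgφ : Integrable (fun x => max (|f (φ x)| - R) 0) μ := hφ.integrable_comp_of_integrable hg
  have hgint : ∫ x, max (|f (φ x)| - R) 0 ∂μ = ∫ x, max (|f x| - R) 0 ∂μ :=
    hcomp _ hg
  -- Use `|f| ≤ max (|f| - R) 0 + R`: invariance makes the integral of the first term independent of
  -- `φ`, and the second is small with `Gᶜ`.
  have hJ : |∫ x in Gᶜ, f (φ x) ∂μ| ≤ ε / 4 + R * δ := by
    calc |∫ x in Gᶜ, f (φ x) ∂μ| ≤ ∫ x in Gᶜ, |f (φ x)| ∂μ := abs_integral_le_integral_abs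
      _ ≤ ∫ x in Gᶜ, (max (|f (φ x)| - R) 0 + R) ∂μ :=
        setIntegral_mono hfφ.abs.integrableOn
          (hgφ.integrableOn.add (integrable_const _).integrableOn)
          fun x => by linarith [le_max_left (|f (φ x)| - R) 0]
      _ = ∫ x in Gᶜ, max (|f (φ x)| - R) 0 ∂μ + μ.real Gᶜ * R := by
        rw [integral_add hgφ.integrableOn (integrable_const _).integrableOn]
        simp
      _ ≤ ε / 4 + R * δ := by
        have h1 := setIntegral_le_integral (s := Gᶜ) hgφ
          (Eventually.of_forall fun x => le_max_right _ _)
        have h2 : μ.real Gᶜ * R ≤ δ * R := by gcongr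
        linarith
  have hadd := integral_add_compl hG hfφ
  rw [hint] at hadd
  have hm : μ.real G = 1 - μ.real Gᶜ := by
    have := probReal_add_probReal_compl (μ := μ) hG
    linarith
  have hmpos : 1 / 2 ≤ μ.real G := by linarith
  have hcond : ∫ x, f (φ x) ∂(ProbabilityTheory.cond μ G) =
      (μ.real G)⁻¹ * ∫ x in G, f (φ x) ∂μ := by
    rw [ProbabilityTheory.cond, integral_smul_measure]
    simp [measureReal_def]
  have hθ : 0 ≤ μ.real Gᶜ := measureReal_nonneg
  have key : (μ.real G)⁻¹ * ∫ x in G, f (φ x) ∂μ - I =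
      (μ.real G)⁻¹ * (μ.real Gᶜ * I - ∫ x in Gᶜ, f (φ x) ∂μ) := by
    have h1 : ∫ x in G, f (φ x) ∂μ = I - ∫ x in Gᶜ, f (φ x) ∂μ := by linarith
    have h2 : μ.real G ≠ 0 := by linarith
    have h3 : μ.real Gᶜ = 1 - μ.real G := by linarith
    rw [h1, h3]
    field_simp
    ring
  rw [hcond, key, abs_mul, abs_of_nonneg (by positivity)]
  have h4 : (μ.real G)⁻¹ ≤ 2 := by
    rw [inv_le_comm₀ (by linarith) (by norm_num)]
    linarith
  have h5 : |μ.real Gᶜ * I - ∫ x in Gᶜ, f (φ x) ∂μ| ≤ ε / 2 := by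
    refine (abs_sub _ _).trans ?_
    rw [abs_mul, abs_of_nonneg hθ]
    have : μ.real Gᶜ * |I| ≤ δ * |I| := by gcongr
    have := hδ.1
    nlinarith
  calc (μ.real G)⁻¹ * |μ.real Gᶜ * I - ∫ x in Gᶜ, f (φ x) ∂μ| ≤ 2 * (ε / 2) := by gcongr
    _ = ε := by ring

/-- A sequence of points of a set of full measure whose empirical averages converge to the means
of countably many integrable functions. -/
theorem exists_seq_tendsto_average {X ι : Type*} [MeasurableSpace X] [Countable ι] (μ : Measure X)
    [IsProbabilityMeasure μ] {G : Set X} (hG : ∀ᵐ x ∂μ, x ∈ G) {g : ι → X → ℝ}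
    (hg : ∀ j, Integrable (g j) μ) :
    ∃ x : ℕ → X, (∀ i, x i ∈ G) ∧ ∀ j,
      Tendsto (fun n : ℕ => (∑ i ∈ Finset.range n, g j (x i)) / n) atTop (𝓝 (∫ x, g j x ∂μ)) := by
  -- Almost every realisation of an i.i.d. sequence of law `μ` works, since countably many null sets
  -- are discarded.
  obtain ⟨Ω, _, P, Y, hY, hlaw, hind, hP⟩ := ProbabilityTheory.exists_iid ℕ μ
  have hG' : ∀ᵐ ω ∂P, ∀ i, Y i ω ∈ G := ae_all_iff.2 fun i => by
    refine ae_of_ae_map (hY i).aemeasurable ?_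
    rwa [(hlaw i).map_eq]
  have hmeas (i j) : AEStronglyMeasurable (g j) (P.map (Y i)) := by
    rw [(hlaw i).map_eq]
    exact (hg j).1
  have hid (i : ℕ) : ProbabilityTheory.IdentDistrib (Y i) (Y 0) P P :=
    ⟨(hY i).aemeasurable, (hY 0).aemeasurable, by rw [(hlaw i).map_eq, (hlaw 0).map_eq]⟩
  have hlln : ∀ᵐ ω ∂P, ∀ j, Tendsto (fun n : ℕ => (∑ i ∈ Finset.range n, g j (Y i ω)) / n) atTop
      (𝓝 (∫ x, g j x ∂μ)) := ae_all_iff.2 fun j => by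
    have h := ProbabilityTheory.strong_law_ae_real (μ := P) (fun i ω => g j (Y i ω))
      ((integrable_map_measure (hmeas 0 j) (hY 0).aemeasurable).1
        ((hlaw 0).map_eq.symm ▸ hg j))
      (fun i k hik => (hind.indepFun hik).comp₀ (hY i).aemeasurable (hY k).aemeasurable
        (hmeas i j).aemeasurable (hmeas k j).aemeasurable)
      (fun i => (hid i).comp_of_aemeasurable (hmeas i j).aemeasurable)
    have e : ∫ ω, g j (Y 0 ω) ∂P = ∫ x, g j x ∂μ := by
      rw [← (hlaw 0).map_eq, integral_map (hY 0).aemeasurable (hmeas 0 j)]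
    simpa only [e] using h
  obtain ⟨ω, h1, h2⟩ := (hG'.and hlln).exists
  exact ⟨fun i => Y i ω, h1, h2⟩

/-! ### Measures on periodic orbits -/

/-- The uniform measure on the first `P` points of the orbit of `p`, with multiplicity. -/
noncomputable def orbitMeasure {X : Type*} [MeasurableSpace X] (T : X → X) (P : ℕ) (p : X) :
    Measure X :=
  (P : ENNReal)⁻¹ • ∑ k ∈ Finset.range P, Measure.dirac (T^[k] p)

section orbitMeasure

variable {X : Type*} [MeasurableSpace X] {T : X → X} {P : ℕ} {p : X}

theorem isProbabilityMeasure_orbitMeasure (hP : 0 < P) :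
    IsProbabilityMeasure (orbitMeasure T P p) := by
  refine ⟨?_⟩
  simp [orbitMeasure, ENNReal.inv_mul_cancel (Nat.cast_ne_zero.2 hP.ne')]

theorem orbitMeasure_eq_zero {s : Set X} (hs : MeasurableSet s) (h : ∀ k, T^[k] p ∉ s) :
    orbitMeasure T P p s = 0 := by
  simp [orbitMeasure, Measure.dirac_apply' _ hs, h]

theorem integral_orbitMeasure [MeasurableSingletonClass X] (f : X → ℝ) :
    ∫ x, f x ∂(orbitMeasure T P p) = birkhoffSum T f P p / P := by
  rw [orbitMeasure, integral_smul_measure, integral_finsetSum_measure fun k _ =>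
    integrable_dirac (by simp)]
  simp [birkhoffSum, div_eq_inv_mul]

theorem ergodic_orbitMeasure (hT : Measurable T) (hp : Function.IsPeriodicPt T P p) :
    Ergodic T (orbitMeasure T P p) := by
  refine ⟨⟨hT, ?_⟩, ⟨fun s hs hTs => ?_⟩⟩
  · have h : ∀ k, Measure.map T (Measure.dirac (T^[k] p)) = Measure.dirac (T^[k + 1] p) :=
      fun k => by rw [Measure.map_dirac' hT, Function.iterate_succ_apply']
    rw [orbitMeasure, Measure.map_smul, Measure.map_finset_sum hT.aemeasurable]
    simp_rw [h]
    congr 1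
    cases P with
    | zero => simp
    | succ P =>
      rw [Finset.sum_range_succ, Finset.sum_range_succ', hp]
      rfl
  -- A strictly invariant set contains all of the orbit or none of it.
  · have hiff : ∀ k, T^[k] p ∈ s ↔ p ∈ s := fun k => by
      induction k with
      | zero => rfl
      | succ k ih =>
        rw [Function.iterate_succ_apply', ← ih]
        conv_rhs => rw [← hTs]
        rfl
    by_cases h : p ∈ s
    · have : orbitMeasure T P p sᶜ = 0 := orbitMeasure_eq_zero hs.compl fun k => by simp [hiff, h]
      exact eventuallyConst_set.2 (Or.inl this)
    · have : orbitMeasure T P p s = 0 := orbitMeasure_eq_zero hs fun k => by simp [hiff, h]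
      exact eventuallyConst_set.2 (Or.inr (measure_eq_zero_iff_ae_notMem.1 this))

end orbitMeasure
namespace MarkovShift

variable {B : Matrix ℕ ℕ (Fin 2)}

theorem exists_mem_periodicMeasures {P : ℕ} (hP : 0 < P) {p : MarkovShift B}
    (hp : Function.IsPeriodicPt (shift B) P p) :
    ∃ ν ∈ periodicMeasures B, ∀ f : MarkovShift B → ℝ,
      ∫ x, f x ∂(ν : Measure (MarkovShift B)) = birkhoffSum (shift B) f P p / P := by
  refine ⟨⟨orbitMeasure (shift B) P p, isProbabilityMeasure_orbitMeasure hP⟩,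
    ⟨ergodic_orbitMeasure continuous_shift.measurable hp, p, ⟨P, hP, hp⟩, ?_⟩,
    fun f => integral_orbitMeasure f⟩
  exact orbitMeasure_eq_zero (Set.countable_range _).measurableSet.compl fun k => by simp

/-- Supplies bounds on connector lengths and costs over the letters below `R`. -/
theorem exists_forall_lt_le {α : Type*} [LinearOrder α] [Nonempty α] (u : ℕ → ℕ → α) (R : ℕ) :
    ∃ K, ∀ a < R, ∀ b < R, u a b ≤ K := by
  obtain ⟨K, hK⟩ := ((Finset.range R ×ˢ Finset.range R).image fun p => u p.1 p.2).exists_le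
  exact ⟨K, fun a ha b hb => hK _ (Finset.mem_image.2 ⟨(a, b), by simp [ha, hb], rfl⟩)⟩

theorem exists_measureReal_le (μ : Measure (MarkovShift B)) [IsProbabilityMeasure μ] {δ : ℝ}
    (hδ : 0 < δ) : ∃ R : ℕ, μ.real {x | R ≤ x.1 0} ≤ δ := by
  have hm (R : ℕ) : MeasurableSet {x : MarkovShift B | R ≤ x.1 0} :=
    (continuous_coord 0).measurable measurableSet_Ici
  have h := tendsto_measure_iInter_atTop (μ := μ) (s := fun R : ℕ => {x | R ≤ x.1 0})
    (fun R => (hm R).nullMeasurableSet) (fun R S hRS x hx => le_trans hRS hx)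
    ⟨0, measure_ne_top _ _⟩
  have he : ⋂ R : ℕ, {x : MarkovShift B | R ≤ x.1 0} = ∅ :=
    Set.eq_empty_of_forall_notMem fun x hx => by
      have := Set.mem_iInter.1 hx (x.1 0 + 1)
      simp at this
  rw [he, measure_empty] at h
  obtain ⟨R, hR⟩ := (h.eventually (gt_mem_nhds (ENNReal.ofReal_pos.2 hδ))).exists
  exact ⟨R, ENNReal.toReal_le_of_le_ofReal hδ.le hR.le⟩

/-- Finitely many integrals of regular functions can be approximated by a periodic measure. -/
theorem exists_periodicMeasure_abs_integral_sub_lt (hB : IsTransitionMatrix B)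
    (htrans : IsTransitive B) {μ : Measure (MarkovShift B)} [IsProbabilityMeasure μ]
    (hμ : MeasurePreserving (shift B) μ μ) {ι : Type*} [Finite ι] {f : ι → MarkovShift B → ℝ}
    {V : ι → ℕ → ℝ} (hf : ∀ j, IsRegular (f j) (V j)) (hint : ∀ j, Integrable (f j) μ)
    {ε : ℝ} (hε : 0 < ε) :
    ∃ ν ∈ periodicMeasures B, ∀ j,
      |∫ x, f j x ∂(ν : Measure (MarkovShift B)) - ∫ x, f j x ∂μ| < ε := by
  set I := fun j => ∫ x, f j x ∂μ
  -- This `δ` serves every iterate of the shift, so it is fixed before `N`; `δ < 1` will give `G`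
  -- positive mass.
  obtain ⟨δ, hδ, hδ0, hδ1⟩ := ((eventually_all.2 fun j =>
    eventually_abs_integral_cond_comp_sub_le (hint j) (by positivity : 0 < ε / 4)).and
      (Ioo_mem_nhdsGT (zero_lt_one' ℝ))).exists
  -- Half of `δ` for each of the two conditions, at times `0` and `N`, defining `G`.
  obtain ⟨R, hR⟩ := exists_measureReal_le μ (half_pos hδ0)
  choose c l hc0 hcl using exists_connector hB htrans
  obtain ⟨L, hL⟩ := exists_forall_lt_le l R
  choose K hK using fun j => exists_forall_lt_le (fun a b =>
    |birkhoffSum (shift B) (f j) (l a b) (c a b)| + ∑ k ∈ Finset.range (l a b), V j k) R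
  -- `K` and `L` depend only on `R`, and the Cesàro means of `V j` vanish, so a long block absorbs
  -- all these costs.
  obtain ⟨N, hN, hN0⟩ : ∃ N : ℕ, (∀ j, ∑ k ∈ Finset.range N, V j k + K j + |I j| * L <
      N * (ε / 4)) ∧ 0 < N := by
    refine ((eventually_all.2 fun j => ?_).and (eventually_gt_atTop 0)).exists
    have h := (hf j).tendsto_zero.cesaro.add
      (tendsto_const_div_atTop_nhds_zero_nat (K j + |I j| * L))
    rw [add_zero] at h
    filter_upwards [h.eventually (gt_mem_nhds (by positivity : 0 < ε / 4)),
      eventually_gt_atTop 0] with N hN hN0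
    have hN0' : (0 : ℝ) < N := Nat.cast_pos.2 hN0
    rw [inv_mul_eq_div, ← add_div, div_lt_iff₀ hN0'] at hN
    linarith
  set G : Set (MarkovShift B) := {x | x.1 0 < R ∧ x.1 N < R}
  have hG : MeasurableSet G :=
    ((continuous_coord 0).measurable measurableSet_Iio).inter
      ((continuous_coord N).measurable measurableSet_Iio)
  have hGc : μ.real Gᶜ ≤ δ := by
    have hsub : Gᶜ ⊆ {x | R ≤ x.1 0} ∪ (shift B)^[N] ⁻¹' {x | R ≤ x.1 0} := fun x hx => by
      simp only [Set.mem_union, Set.mem_preimage, Set.mem_ofPred_eq, iterate_shift_apply, zero_add]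
      by_contra! h
      exact hx h
    have hm : MeasurableSet {x : MarkovShift B | R ≤ x.1 0} :=
      (continuous_coord 0).measurable measurableSet_Ici
    have h1 : μ.real ((shift B)^[N] ⁻¹' {x | R ≤ x.1 0}) = μ.real {x | R ≤ x.1 0} :=
      congrArg ENNReal.toReal ((hμ.iterate N).measure_preimage hm.nullMeasurableSet)
    calc μ.real Gᶜ ≤ _ := measureReal_mono hsub
      _ ≤ _ := measureReal_union_le _ _
      _ ≤ δ := by rw [h1]; linarith
  have hGpos : μ G ≠ 0 := fun h => by
    have h1 := probReal_add_probReal_compl (μ := μ) hG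
    rw [measureReal_def, h, ENNReal.toReal_zero] at h1
    linarith
  have := ProbabilityTheory.cond_isProbabilityMeasure hGpos
  have hcomp (j k) : Integrable (fun x => f j ((shift B)^[k] x)) (ProbabilityTheory.cond μ G) :=
    (((hμ.iterate k).integrable_comp_of_integrable (hint j)).integrableOn (s := G)).smul_measure
      (ENNReal.inv_ne_top.2 hGpos)
  obtain ⟨x, hxG, hx⟩ := exists_seq_tendsto_average (ProbabilityTheory.cond μ G)
    (ProbabilityTheory.ae_cond_mem hG) (g := fun j => birkhoffSum (shift B) (f j) N)
    (fun j => integrable_finsetSum _ fun k _ => hcomp j k)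
  have hmean (j) : |∫ y, birkhoffSum (shift B) (f j) N y ∂(ProbabilityTheory.cond μ G) - N * I j| ≤
      N * (ε / 4) := by
    have h1 : ∫ y, birkhoffSum (shift B) (f j) N y ∂(ProbabilityTheory.cond μ G) - N * I j =
        ∑ k ∈ Finset.range N,
          (∫ y, f j ((shift B)^[k] y) ∂(ProbabilityTheory.cond μ G) - I j) := by
      simp only [birkhoffSum]
      rw [integral_finsetSum _ fun k _ => hcomp j k]
      simp
    rw [h1]
    refine (Finset.abs_sum_le_sum_abs _ _).trans ((Finset.sum_le_sum fun k _ =>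
      hδ j _ (hμ.iterate k) G hG hGc).trans (by simp))
  -- Of `ε / 2`, one half is the sampling error and the other the conditioning error `hmean`.
  obtain ⟨M, hM⟩ : ∃ M : ℕ, ∀ j, |(∑ i ∈ Finset.range (M + 1), birkhoffSum (shift B) (f j) N (x i)) -
      (M + 1) * (N * I j)| ≤ (M + 1) * (N * (ε / 2)) := by
    refine (eventually_all.2 fun j => ?_).exists (f := atTop)
    have hpos : 0 < N * (ε / 4) := by positivity
    filter_upwards [(hx j).comp (tendsto_add_atTop_nat 1) (Metric.ball_mem_nhds _ hpos)] with M hM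
    have hM' := Metric.mem_ball.1 hM
    simp only [Function.comp, Real.dist_eq] at hM'
    push_cast at hM'
    have hMpos : (0 : ℝ) < M + 1 := by positivity
    have h2 := (abs_sub_le _ _ _).trans (add_le_add hM'.le (hmean j))
    have h3 := mul_le_mul_of_nonneg_left h2 hMpos.le
    rw [← abs_of_pos hMpos, ← abs_mul, abs_of_pos hMpos, mul_sub, mul_div_cancel₀ _ hMpos.ne'] at h3
    linarith
  -- The last connector returns to the first letter of sample `0`, which closes the word.
  obtain ⟨z, P, hz0, hzP, hP1, hP2, hz⟩ := exists_chain (F := Set.Iio R) (N := N) (L := L) (c := c)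
    (l := l) (fun a ha b hb => ⟨hc0 a b, hcl a b, hL a ha b hb⟩) hxG M (hxG 0).1
  have hP : 0 < P := lt_of_lt_of_le (by positivity) hP1
  obtain ⟨p, hp, hpz⟩ := exists_isPeriodicPt hP (hzP.trans hz0.symm)
  obtain ⟨ν, hν, hνf⟩ := exists_mem_periodicMeasures hP hp
  refine ⟨ν, hν, fun j => ?_⟩
  have hP' : (0 : ℝ) < P := Nat.cast_pos.2 hP
  have h1 := hz (f j) (V j) (hf j) (K j) (fun a ha b hb => hK j a ha b hb) p hpz
  have h2 := hM j
  have hP1' : ((M : ℝ) + 1) * N ≤ P := by exact_mod_cast hP1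
  have hP2' : (P : ℝ) ≤ (M + 1) * (N + L) := by exact_mod_cast hP2
  have h3 : |(M + 1) * (N * I j) - P * I j| ≤ (M + 1) * (|I j| * L) := by
    rw [← mul_assoc, ← sub_mul, abs_mul, abs_sub_comm, abs_of_nonneg (by linarith)]
    calc (P - (M + 1) * N) * |I j| ≤ ((M + 1) * L) * |I j| := by
          gcongr
          linarith
      _ = _ := by ring
  have h4 : ((M : ℝ) + 1) * (∑ k ∈ Finset.range N, V j k + K j + |I j| * L) <
      (M + 1) * (N * (ε / 4)) := mul_lt_mul_of_pos_left (hN j) (by positivity)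
  -- Variation, connectors and excess length cost less than `(M + 1) N ε / 4`, sampling and
  -- conditioning `(M + 1) N ε / 2`; the total is below `P ε`.
  have h5 := (abs_sub_le _ _ _).trans (add_le_add ((abs_sub_le _ _ _).trans (add_le_add h1 h2)) h3)
  have h6 : ((M : ℝ) + 1) * N * ε ≤ P * ε := by gcongr
  have h7 : 0 < ((M : ℝ) + 1) * (N * ε) := by positivity
  rw [hνf, ← mul_lt_mul_iff_right₀ hP', ← abs_of_pos hP', ← abs_mul, abs_of_pos hP', mul_sub,
    mul_div_cancel₀ _ hP'.ne']
  refine h5.trans_lt ?_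
  linarith

/-! ### Regular test functions and weak convergence -/

theorem isRegular_of_uniformContinuous {τ : MarkovShift B → ℝ} (hτ : UniformContinuous τ)
    (hvar : variation τ 2 < ⊤) : IsRegular τ fun n => (variation τ (n + 2)).toReal := by
  have hle : ∀ n, variation τ (n + 2) ≤ variation τ 2 := fun n =>
    iSup_mono fun x => iSup_mono fun y => iSup_mono' fun h =>
      ⟨h.trans (pow_le_pow_of_le_one (by norm_num) (by norm_num) (by omega)), le_rfl⟩
  refine ⟨fun n x y h => ?_, ?_⟩
  -- Finiteness matters: `toReal` would send an infinite variation to `0`.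
  · rw [← ENNReal.ofReal_le_iff_le_toReal ((hle n).trans_lt hvar).ne]
    exact le_iSup_of_le x (le_iSup_of_le y (le_iSup_of_le ((dist_le_iff x y _).2 h) le_rfl))
  · refine Metric.tendsto_atTop.2 fun ε hε => ?_
    obtain ⟨δ, hδ, h⟩ := Metric.uniformContinuous_iff.1 hτ (ε / 2) (by positivity)
    obtain ⟨n, hn⟩ := exists_pow_lt_of_lt_one hδ (by norm_num : (1 / 2 : ℝ) < 1)
    refine ⟨n, fun m hm => ?_⟩
    rw [Real.dist_eq, sub_zero, abs_of_nonneg ENNReal.toReal_nonneg]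
    refine lt_of_le_of_lt (ENNReal.toReal_le_of_le_ofReal (by positivity) ?_) (half_lt_self hε)
    refine iSup_le fun x => iSup_le fun y => iSup_le fun hxy => ENNReal.ofReal_le_ofReal ?_
    exact (h (hxy.trans_lt <| lt_of_le_of_lt
      (pow_le_pow_of_le_one (by norm_num) (by norm_num) (by omega)) hn)).le

/-- The set of points that begin with the word `w`. -/
def cylinder (B : Matrix ℕ ℕ (Fin 2)) (w : Σ n, Fin n → ℕ) : Set (MarkovShift B) :=
  {x | ∀ i, x.1 (i : Fin w.1) = w.2 i}

theorem measurableSet_cylinder (w : Σ n, Fin n → ℕ) : MeasurableSet (cylinder B w) := by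
  rw [cylinder, Set.ofPred_forall]
  exact MeasurableSet.iInter fun i =>
    (continuous_coord _).measurable (measurableSet_singleton (w.2 i))

theorem cylinder_eq {w : Σ n, Fin n → ℕ} {x : MarkovShift B} (hx : x ∈ cylinder B w) :
    cylinder B w = {y | ∀ i < w.1, y.1 i = x.1 i} := by
  ext y
  exact ⟨fun hy i hi => (hy ⟨i, hi⟩).trans (hx ⟨i, hi⟩).symm,
    fun hy i => (hy i i.2).trans (hx i)⟩

theorem isRegular_indicator_cylinder (w : Σ n, Fin n → ℕ) :
    IsRegular ((cylinder B w).indicator fun _ => (1 : ℝ)) fun n => if n < w.1 then 1 else 0 := by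
  refine ⟨fun n x y h => ?_, tendsto_const_nhds.congr' ?_⟩
  · split_ifs with hn
    · by_cases hx : x ∈ cylinder B w <;> by_cases hy : y ∈ cylinder B w <;> simp [hx, hy]
    · have hiff : x ∈ cylinder B w ↔ y ∈ cylinder B w :=
        forall_congr' fun i => by rw [h i (by omega)]
      by_cases hy : y ∈ cylinder B w <;> simp [hiff, hy]
  · filter_upwards [eventually_ge_atTop w.1] with n hn
    rw [if_neg (by omega)]

/-- Two cylinders with a common point `x` meet in the cylinder of the longer prefix of `x`. -/
theorem isPiSystem_range_cylinder : IsPiSystem (Set.range (cylinder B)) := by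
  rintro _ ⟨v, rfl⟩ _ ⟨w, rfl⟩ ⟨x, hv, hw⟩
  rw [cylinder_eq hv, cylinder_eq hw]
  refine ⟨⟨max v.1 w.1, fun i => x.1 i⟩, ?_⟩
  rw [cylinder_eq (x := x) fun i => rfl]
  ext y
  simp only [lt_max_iff, Set.mem_ofPred_eq, Set.mem_inter_iff]
  exact ⟨fun h => ⟨fun i hi => h i (Or.inl hi), fun i hi => h i (Or.inr hi)⟩,
    fun h i hi => hi.elim (h.1 i) (h.2 i)⟩

theorem exists_cylinder_subset {U : Set (MarkovShift B)} (hU : IsOpen U) {x : MarkovShift B}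
    (hx : x ∈ U) : ∃ s ∈ Set.range (cylinder B), s ∈ 𝓝 x ∧ s ⊆ U := by
  obtain ⟨ε, hε, hU⟩ := Metric.isOpen_iff.1 hU x hx
  obtain ⟨n, hn⟩ := exists_pow_lt_of_lt_one hε (by norm_num : (1 / 2 : ℝ) < 1)
  refine ⟨_, ⟨⟨n, fun i => x.1 i⟩, rfl⟩, ?_⟩
  rw [cylinder_eq (x := x) fun i => rfl]
  exact ⟨(isOpen_setOf_agree x n).mem_nhds fun i _ => rfl,
    fun y hy => hU (Metric.mem_ball.2 (((dist_le_iff y x n).2 hy).trans_lt hn))⟩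

instance instSecondCountableTopology (B : Matrix ℕ ℕ (Fin 2)) :
    SecondCountableTopology (MarkovShift B) := by
  let := PiNat.metricSpaceNatNat
  exact (Topology.IsInducing.induced (Subtype.val : MarkovShift B → ℕ → ℕ)).secondCountableTopology

/-- Cylinders form a π-system containing small neighbourhoods of every point of a second countable
space, so convergence on them implies weak convergence without a separate tightness argument. -/
theorem tendsto_of_tendsto_integral_cylinder {ν : ℕ → ProbabilityMeasure (MarkovShift B)}
    {μ : ProbabilityMeasure (MarkovShift B)}
    (h : ∀ w, Tendsto (fun n => ∫ x, (cylinder B w).indicator (fun _ => (1 : ℝ)) x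
      ∂(ν n : Measure (MarkovShift B))) atTop
      (𝓝 (∫ x, (cylinder B w).indicator (fun _ => (1 : ℝ)) x ∂(μ : Measure (MarkovShift B))))) :
    Tendsto ν atTop (𝓝 μ) := by
  refine isPiSystem_range_cylinder.tendsto_probabilityMeasure_of_tendsto_of_mem ?_
    (fun U hU x hx => exists_cylinder_subset hU hx) ?_
  · rintro _ ⟨w, rfl⟩
    exact measurableSet_cylinder w
  · rintro _ ⟨w, rfl⟩
    have := h w
    simp only [integral_indicator_const _ (measurableSet_cylinder w), smul_eq_mul, mul_one] at this
    exact NNReal.tendsto_coe.1 this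

end MarkovShift

theorem mainTheorem10 (B : Matrix ℕ ℕ (Fin 2)) (hB : IsTransitionMatrix B)
    (htrans : MarkovShift.IsTransitive B)
    (τ : MarkovShift B → ℝ) (hτ : UniformContinuous τ) (hvar : MarkovShift.variation τ 2 < ⊤)
    (μ : ProbabilityMeasure (MarkovShift B)) (hμ : μ ∈ MarkovShift.integrableMeasures B τ) :
    ∃ ν : ℕ → ProbabilityMeasure (MarkovShift B),
      (∀ n, ν n ∈ MarkovShift.periodicMeasures B) ∧
      Tendsto ν atTop (𝓝 μ) ∧
      Tendsto (fun n => ∫ x, τ x ∂(ν n : Measure (MarkovShift B))) atTop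
        (𝓝 (∫ x, τ x ∂(μ : Measure (MarkovShift B)))) := by
  -- `none` stands for `τ` and `some w` for a cylinder; `ν n` treats the first `n + 1` functions of
  -- the enumeration with error `1 / (n + 1)`.
  obtain ⟨e, he⟩ := exists_surjective_nat (Option (Σ n, Fin n → ℕ))
  let g : Option (Σ n, Fin n → ℕ) → MarkovShift B → ℝ := fun o =>
    o.elim τ fun w => (MarkovShift.cylinder B w).indicator fun _ => (1 : ℝ)
  have hg : ∀ o, ∃ V, MarkovShift.IsRegular (g o) V := by
    rintro (_ | w)
    · exact ⟨_, MarkovShift.isRegular_of_uniformContinuous hτ hvar⟩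
    · exact ⟨_, MarkovShift.isRegular_indicator_cylinder w⟩
  choose V hV using hg
  have hint : ∀ o, Integrable (g o) (μ : Measure (MarkovShift B)) := by
    rintro (_ | w)
    · exact hμ.2
    · exact (integrable_const _).indicator (MarkovShift.measurableSet_cylinder w)
  choose ν hν hclose using fun n : ℕ =>
    MarkovShift.exists_periodicMeasure_abs_integral_sub_lt hB htrans hμ.1
      (f := fun j : Fin (n + 1) => g (e j)) (fun j => hV (e j)) (fun j => hint (e j))
      (Nat.one_div_pos_of_nat (α := ℝ) (n := n))
  have htend : ∀ o, Tendsto (fun n => ∫ x, g o x ∂(ν n : Measure (MarkovShift B))) atTop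
      (𝓝 (∫ x, g o x ∂(μ : Measure (MarkovShift B)))) := fun o => by
    obtain ⟨k, rfl⟩ := he o
    rw [tendsto_iff_dist_tendsto_zero]
    refine squeeze_zero' (Eventually.of_forall fun n => dist_nonneg) ?_
      (tendsto_one_div_add_atTop_nhds_zero_nat (𝕜 := ℝ))
    filter_upwards [eventually_ge_atTop k] with n hn
    exact (hclose n ⟨k, by omega⟩).le
  exact ⟨ν, hν, MarkovShift.tendsto_of_tendsto_integral_cylinder fun w => htend (some w),
    htend none⟩
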